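/- Let $X$ be a real Banach space with $\dim X\ge 2$. Let $Lip_0(X)$ be the space of all Lipschitz functions $f:X\to\mathbb{R}$ with $f(0)=0$, normed by $Lip(f)=\sup_{x\ne y}\frac{|f(x)-f(y)|}{\|x-y\|}$, and let $Lip_0^{ph}(X)$ be its subspace of positively homogeneous functions, that is, of those $f$ with $f(\alpha x)=\alpha f(x)$ for all $\alpha\ge 0$ and $x\in X$, with the same norm. For $x\in X$ let $\delta_x^{ph}\in Lip_0^{ph}(X)^*$ be the evaluation functional $\delta_x^{ph}(f)=f(x)$, and let $$F^{ph}(X)=\overline{\operatorname{span}}^{\|\cdot\|}\{\delta_x^{ph}:x\in X\}\subseteq Lip_0^{ph}(X)^*$$ be the canonical predual of $Lip_0^{ph}(X)$. Then $F^{ph}(X)$ contains a closed linear subspace that is linearly homeomorphic to $L^1(\mathbb{R})$ (real-valued, with respect to Lebesgue measure), and $Lip_0^{ph}(X)$ is infinite-dimensional. -/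

import Mathlib

open scoped NNReal
open MeasureTheory

/-- The vector space of Lipschitz functions `X → ℝ` that vanish at `0`. -/
def lip0Submodule (X : Type*) [NormedAddCommGroup X] : Submodule ℝ (X → ℝ) where
  carrier := {f | (∃ K : ℝ≥0, LipschitzWith K f) ∧ f 0 = 0}
  zero_mem' := ⟨⟨0, LipschitzWith.const 0⟩, rfl⟩
  add_mem' := by
    rintro f g ⟨⟨K, hK⟩, hf⟩ ⟨⟨L, hL⟩, hg⟩
    exact ⟨⟨K + L, hK.add hL⟩, by simp [hf, hg]⟩
  smul_mem' := by
    rintro c f ⟨⟨K, hK⟩, hf⟩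
    refine ⟨⟨‖c‖₊ * K, LipschitzWith.of_dist_le_mul fun x y => ?_⟩, by simp [hf]⟩
    have h := hK.dist_le_mul x y
    rw [Real.dist_eq] at h ⊢
    simp only [Pi.smul_apply, smul_eq_mul, NNReal.coe_mul, coe_nnnorm, Real.norm_eq_abs]
    rw [← mul_sub, abs_mul, mul_assoc]
    exact mul_le_mul_of_nonneg_left h (abs_nonneg c)

/-- `Lip₀(X)`: the Lipschitz functions `X → ℝ` that vanish at `0`. This is a separate type (not a
subtype coming from `lip0Submodule X`), so that its topology is the one given by the Lipschitz norm
below and not the topology of pointwise convergence. -/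
def Lip0 (X : Type*) [NormedAddCommGroup X] : Type _ := ↥(lip0Submodule X)

namespace Lip0

variable {X : Type*} [NormedAddCommGroup X]

instance : AddCommGroup (Lip0 X) := inferInstanceAs (AddCommGroup ↥(lip0Submodule X))

instance : Module ℝ (Lip0 X) := inferInstanceAs (Module ℝ ↥(lip0Submodule X))

instance : CoeFun (Lip0 X) (fun _ => X → ℝ) := ⟨fun f => f.1⟩

theorem ext {f g : Lip0 X} (h : ∀ x, f x = g x) : f = g := Subtype.ext (funext h)

@[simp] theorem zero_apply (x : X) : (0 : Lip0 X) x = 0 := rfl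

@[simp] theorem add_apply (f g : Lip0 X) (x : X) : (f + g) x = f x + g x := rfl

@[simp] theorem neg_apply (f : Lip0 X) (x : X) : (-f) x = -f x := rfl

@[simp] theorem smul_apply (c : ℝ) (f : Lip0 X) (x : X) : (c • f) x = c * f x := rfl

@[simp] theorem map_zero (f : Lip0 X) : f 0 = 0 := f.2.2

/-- The set of slopes `|f x - f y| / ‖x - y‖`, over all `x ≠ y`. -/
def slopes (f : Lip0 X) : Set ℝ := {r | ∃ x y : X, x ≠ y ∧ r = |f x - f y| / ‖x - y‖}

/-- The Lipschitz number `Lip(f) = sup_{x ≠ y} |f x - f y| / ‖x - y‖`. -/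
noncomputable def lipNumber (f : Lip0 X) : ℝ := sSup f.slopes

theorem bddAbove_slopes (f : Lip0 X) : BddAbove f.slopes := by
  obtain ⟨K, hK⟩ := f.2.1
  refine ⟨K, ?_⟩
  rintro r ⟨x, y, hxy, rfl⟩
  rw [div_le_iff₀ (norm_pos_iff.2 (sub_ne_zero.2 hxy)), ← dist_eq_norm, ← Real.dist_eq]
  exact hK.dist_le_mul x y

theorem lipNumber_nonneg (f : Lip0 X) : 0 ≤ f.lipNumber := by
  refine Real.sSup_nonneg ?_
  rintro r ⟨x, y, -, rfl⟩
  positivity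

theorem abs_sub_le (f : Lip0 X) (x y : X) : |f x - f y| ≤ f.lipNumber * ‖x - y‖ := by
  rcases eq_or_ne x y with rfl | hxy
  · simp
  · rw [← div_le_iff₀ (norm_pos_iff.2 (sub_ne_zero.2 hxy))]
    exact le_csSup f.bddAbove_slopes ⟨x, y, hxy, rfl⟩

theorem lipNumber_le (f : Lip0 X) {C : ℝ} (hC : 0 ≤ C)
    (h : ∀ x y, |f x - f y| ≤ C * ‖x - y‖) : f.lipNumber ≤ C := by
  refine Real.sSup_le ?_ hC
  rintro r ⟨x, y, hxy, rfl⟩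
  rw [div_le_iff₀ (norm_pos_iff.2 (sub_ne_zero.2 hxy))]
  exact h x y

theorem abs_le (f : Lip0 X) (x : X) : |f x| ≤ f.lipNumber * ‖x‖ := by
  simpa using f.abs_sub_le x 0

/-- The Lipschitz number is a norm on `Lip₀(X)`. -/
noncomputable def lipNorm (X : Type*) [NormedAddCommGroup X] : AddGroupNorm (Lip0 X) where
  toFun := lipNumber
  map_zero' := le_antisymm (lipNumber_le 0 le_rfl (by simp)) (lipNumber_nonneg 0)
  add_le' f g := by
    refine lipNumber_le _ (add_nonneg f.lipNumber_nonneg g.lipNumber_nonneg) fun x y => ?_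
    have e : (f + g) x - (f + g) y = (f x - f y) + (g x - g y) := by
      simp only [add_apply]; ring
    rw [e, add_mul]
    exact (abs_add_le _ _).trans (add_le_add (f.abs_sub_le x y) (g.abs_sub_le x y))
  neg' f := by
    have e : (-f).slopes = f.slopes := by
      refine Set.ext fun r => ?_
      constructor <;> rintro ⟨x, y, h, hr⟩ <;> refine ⟨y, x, h.symm, ?_⟩ <;>
        simpa [norm_sub_rev y x, neg_add_eq_sub] using hr
    simp only [lipNumber, e]
  eq_zero_of_map_eq_zero' f hf := by
    refine ext fun x => ?_
    have h := f.abs_le x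
    rw [show f.lipNumber = 0 from hf, zero_mul] at h
    simpa using abs_nonpos_iff.1 h

/-- `Lip₀(X)` is normed by `‖f‖ = Lip(f)`. -/
noncomputable instance : NormedAddCommGroup (Lip0 X) := (lipNorm X).toNormedAddCommGroup

theorem norm_def (f : Lip0 X) : ‖f‖ = f.lipNumber := rfl

noncomputable instance : NormedSpace ℝ (Lip0 X) where
  norm_smul_le c f := by
    refine lipNumber_le _ (mul_nonneg (norm_nonneg c) f.lipNumber_nonneg) fun x y => ?_
    rw [smul_apply, smul_apply, ← mul_sub, abs_mul, Real.norm_eq_abs, mul_assoc]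
    exact mul_le_mul_of_nonneg_left (f.abs_sub_le x y) (abs_nonneg c)

/-- The evaluation functional `δ_x : f ↦ f x` in the dual of `Lip₀(X)`. -/
noncomputable def delta (x : X) : StrongDual ℝ (Lip0 X) :=
  LinearMap.mkContinuous
    { toFun := fun f => f x
      map_add' := fun _ _ => rfl
      map_smul' := fun _ _ => rfl } ‖x‖
    fun f => by
      rw [mul_comm]
      exact f.abs_le x

@[simp] theorem delta_apply (x : X) (f : Lip0 X) : delta x f = f x := rfl

end Lip0

/-- `Lip₀^{ph}(X)`: the positively homogeneous functions in `Lip₀(X)`, with the Lipschitz norm. -/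
def Lip0ph (X : Type*) [NormedAddCommGroup X] [NormedSpace ℝ X] : Submodule ℝ (Lip0 X) where
  carrier := {f | ∀ a : ℝ, 0 ≤ a → ∀ x : X, f (a • x) = a * f x}
  zero_mem' := by intro a _ x; simp
  add_mem' := by
    intro f g hf hg a ha x
    simp only [Lip0.add_apply, hf a ha x, hg a ha x]; ring
  smul_mem' := by
    intro c f hf a ha x
    simp only [Lip0.smul_apply, hf a ha x]; ring

/-- `δ_x^{ph}`: the restriction of `δ_x` to `Lip₀^{ph}(X)`. -/
noncomputable def deltaPh {X : Type*} [NormedAddCommGroup X] [NormedSpace ℝ X] (x : X) :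
    StrongDual ℝ (Lip0ph X) :=
  (Lip0.delta x).comp (Lip0ph X).subtypeL

/-- `F^{ph}(X)`: the norm-closed linear span of the functionals `δ_x^{ph}`, `x ∈ X`, in the dual of
`Lip₀^{ph}(X)`. -/
noncomputable def Fph (X : Type*) [NormedAddCommGroup X] [NormedSpace ℝ X] :
    Submodule ℝ (StrongDual ℝ (Lip0ph X)) :=
  (Submodule.span ℝ (Set.range (deltaPh (X := X)))).topologicalClosure

/-!
For linearly independent `e, v : X`, a function `g ∈ L¹(ℝ)` defines the functional
`f ↦ ∫ g(s) (d/ds) f(e + s v) ds` on `Lip₀^{ph}(X)` (`lineDerivIntegral`), bounded because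
`s ↦ f(e + s v)` is Lipschitz. It sends the indicator of `(a, b]` to `δ_{e + b v} - δ_{e + a v}`, and
such indicators are total in `L¹(ℝ)`, so its values lie in `F^{ph}(X)`
(`lineDerivIntegral_mem_Fph`).

Homogeneity relates the values of `f` only along rays, and each ray meets the line at most once.
Thus on a bounded piece of the line the values of `f` are arbitrary up to a constant: every
`1`-Lipschitz `φ` on `[-M, M]` with `φ 0 = 0` is `s ↦ f(e + s v)` for a positively homogeneous `f`
whose norm is bounded independently of `φ` (`exists_lip0ph_eq_on_segment`). For `X = ℝ²` this is
`f(x, y) = x⁺ φ(y / x⁺)` with `y` clamped to the cone over the segment; in general one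
composes with two functionals biorthogonal to `e, v`. Testing against the `f` whose trace `φ` is a
primitive of `sign g` shows that the operator is bounded below on functions supported in `[-M, M]`
(`norm_le_mul_norm_lineDerivIntegral`). The bound grows with `M`, whence the restriction to a
bounded piece; it costs nothing because the substitution `x = tan s` embeds `L¹(ℝ)` isometrically
into the functions supported in `(-π/2, π/2)`
(`exists_linearIsometry_L1_supported_Ioo`).

The composite is an isomorphism onto its closed range. If `Lip₀^{ph}(X)` were finite-dimensional,
so would be its dual, and with it `L¹(ℝ)`.
-/

open Set Filter Topology

/-! ### Density of interval indicators in `L¹(ℝ)` -/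

/-- A closed subspace containing the indicators of an increasing sequence of sets contains the
indicator of their union. -/
theorem indicatorConstLp_iUnion_mem_of_monotone {V : Submodule ℝ (Lp ℝ 1 (volume : Measure ℝ))}
    (hV : IsClosed (V : Set (Lp ℝ 1 (volume : Measure ℝ)))) {t : ℕ → Set ℝ} (htm : Monotone t)
    (ht : ∀ n, MeasurableSet (t n)) (hμt : ∀ n, volume (t n) ≠ ⊤)
    (hmem : ∀ n, indicatorConstLp 1 (ht n) (hμt n) (1 : ℝ) ∈ V)
    (hs : MeasurableSet (⋃ n, t n)) (hμs : volume (⋃ n, t n) ≠ ⊤) :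
    indicatorConstLp 1 hs hμs (1 : ℝ) ∈ V := by
  refine hV.mem_of_tendsto (tendsto_indicatorConstLp_set (l := atTop) (ht := ht) (hμt := hμt)
    ENNReal.one_ne_top ?_) (Eventually.of_forall hmem)
  have hsub (n : ℕ) : symmDiff (t n) (⋃ n, t n) = (⋃ n, t n) \ t n := by
    rw [symmDiff_def]
    simp [sdiff_eq_bot_iff.2 (subset_iUnion t n)]
  simp_rw [hsub]
  have h := tendsto_measure_iInter_atTop (μ := (volume : Measure ℝ))
    (s := fun n => (⋃ n, t n) \ t n) (fun n => (hs.diff (ht n)).nullMeasurableSet)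
    (fun m n hmn => sdiff_subset_sdiff_right (htm hmn))
    ⟨0, measure_ne_top_of_subset sdiff_subset hμs⟩
  have he : (⋂ n, (⋃ n, t n) \ t n) = ∅ := by
    rw [← sdiff_iUnion, sdiff_self]
  simpa [he, Function.comp_def] using h

/-- The indicators of bounded intervals span a dense subspace of `L¹(ℝ)`. -/
theorem eq_top_of_indicatorConstLp_Ioc_mem {V : Submodule ℝ (Lp ℝ 1 (volume : Measure ℝ))}
    (hV : IsClosed (V : Set (Lp ℝ 1 (volume : Measure ℝ))))
    (hIoc : ∀ (a b : ℝ) (hm : MeasurableSet (Ioc a b)) (hμ : volume (Ioc a b) ≠ ⊤),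
      indicatorConstLp 1 hm hμ (1 : ℝ) ∈ V) : V = ⊤ := by
  have hfin (n : ℕ) (A : Set ℝ) : volume (A ∩ Ioc (-(n : ℝ)) n) ≠ ⊤ :=
    measure_ne_top_of_subset inter_subset_right measure_Ioc_lt_top.ne
  -- the sets whose trace on every bounded window has its indicator in `V` form a λ-system
  have key (A : Set ℝ) (hA : MeasurableSet A) : ∀ n : ℕ,
      indicatorConstLp 1 (hA.inter measurableSet_Ioc) (hfin n A) (1 : ℝ) ∈ V := by
    induction A, hA using MeasurableSpace.induction_on_inter
      (((BorelSpace.measurable_eq (α := ℝ)).trans (borel_eq_generateFrom_Iic ℝ)))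
      isPiSystem_Iic with
    | empty =>
      intro n
      simp only [empty_inter]
      convert V.zero_mem
      exact indicatorConstLp_empty
    | basic t ht =>
      obtain ⟨a, rfl⟩ := ht
      intro n
      have he : Iic a ∩ Ioc (-(n : ℝ)) n = Ioc (-(n : ℝ)) (min n a) := by
        rw [inter_comm, Ioc_inter_Iic]
      simp only [he]
      exact hIoc _ _ _ _
    | compl t ht ih =>
      intro n
      have hd : Disjoint (t ∩ Ioc (-(n : ℝ)) n) (tᶜ ∩ Ioc (-(n : ℝ)) n) :=
        (disjoint_compl_right (a := t)).mono inter_subset_left inter_subset_left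
      have hu : t ∩ Ioc (-(n : ℝ)) n ∪ tᶜ ∩ Ioc (-(n : ℝ)) n = Ioc (-(n : ℝ)) n := by
        rw [← union_inter_distrib_right, union_compl_self, univ_inter]
      have h := indicatorConstLp_disjoint_union (p := 1) (ht.inter measurableSet_Ioc)
        (ht.compl.inter measurableSet_Ioc) (hfin n t) (hfin n tᶜ) hd (1 : ℝ)
      simp only [hu] at h
      rw [← V.add_mem_iff_right (ih n), ← h]
      exact hIoc _ _ _ _
    | iUnion f hdis hf ih =>
      intro n
      have hm (k : ℕ) : MeasurableSet ((⋃ i < k, f i) ∩ Ioc (-(n : ℝ)) n) :=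
        (MeasurableSet.biUnion (to_countable _) fun i _ => hf i).inter measurableSet_Ioc
      have hpart (k : ℕ) : indicatorConstLp 1 (hm k) (hfin n _) (1 : ℝ) ∈ V := by
        induction k with
        | zero =>
          have he : (⋃ i < 0, f i) ∩ Ioc (-(n : ℝ)) n = ∅ := by simp
          simp only [he]
          convert V.zero_mem
          exact indicatorConstLp_empty
        | succ k ihk =>
          have hd : Disjoint ((⋃ i < k, f i) ∩ Ioc (-(n : ℝ)) n) (f k ∩ Ioc (-(n : ℝ)) n) := by
            refine Disjoint.mono inter_subset_left inter_subset_left ?_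
            simp only [disjoint_iUnion_left]
            exact fun i hi => hdis hi.ne
          have h := indicatorConstLp_disjoint_union (p := 1) (hm k)
            ((hf k).inter measurableSet_Ioc) (hfin n _) (hfin n _) hd (1 : ℝ)
          have hu : (⋃ i < k + 1, f i) ∩ Ioc (-(n : ℝ)) n =
              (⋃ i < k, f i) ∩ Ioc (-(n : ℝ)) n ∪ f k ∩ Ioc (-(n : ℝ)) n := by
            rw [biUnion_lt_succ, union_inter_distrib_right]
          simp only [hu]
          rw [h]
          exact V.add_mem ihk (ih k n)
      have hun : (⋃ i, f i) ∩ Ioc (-(n : ℝ)) n = ⋃ k, (⋃ i < k, f i) ∩ Ioc (-(n : ℝ)) n := by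
        rw [← iUnion_inter]
        congr 1
        ext x
        simp only [mem_iUnion]
        exact ⟨fun ⟨i, hi⟩ => ⟨i + 1, i, by omega, hi⟩, fun ⟨_, i, _, hi⟩ => ⟨i, hi⟩⟩
      simp only [hun]
      refine indicatorConstLp_iUnion_mem_of_monotone hV (fun k l hkl => ?_) hm
        (fun k => hfin n _) hpart _ _
      exact inter_subset_inter_left _ (biUnion_subset_biUnion_left fun i hi => lt_of_lt_of_le hi hkl)
  have hset (A : Set ℝ) (hA : MeasurableSet A) (hμ : volume A ≠ ⊤) :
      indicatorConstLp 1 hA hμ (1 : ℝ) ∈ V := by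
    have hun : A = ⋃ n : ℕ, A ∩ Ioc (-(n : ℝ)) n := by
      refine Subset.antisymm (fun x hx => ?_) (iUnion_subset fun n => inter_subset_left)
      obtain ⟨n, hn⟩ := exists_nat_gt |x|
      exact mem_iUnion.2 ⟨n, hx, (abs_lt.1 hn).1, (abs_lt.1 hn).2.le⟩
    have hA' := hA
    have hμ' := hμ
    rw [hun] at hA' hμ'
    have h := indicatorConstLp_iUnion_mem_of_monotone hV
      (t := fun n : ℕ => A ∩ Ioc (-(n : ℝ)) n)
      (fun k l hkl => inter_subset_inter_right _ (Ioc_subset_Ioc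
        (neg_le_neg (Nat.cast_le.2 hkl)) (Nat.cast_le.2 hkl)))
      (fun n => hA.inter measurableSet_Ioc) (fun n => hfin n A) (key A hA) hA' hμ'
    simpa only [← hun] using h
  refine eq_top_iff.2 fun g _ => ?_
  refine Lp.induction ENNReal.one_ne_top (fun g => g ∈ V) ?_ ?_ hV g
  · intro c s hs hμs
    rw [Lp.simpleFunc.coe_indicatorConst]
    have h : indicatorConstLp 1 hs hμs.ne c = c • indicatorConstLp 1 hs hμs.ne (1 : ℝ) := by
      refine Lp.ext ?_
      filter_upwards [indicatorConstLp_coeFn (p := 1) (hs := hs) (hμs := hμs.ne) (c := c),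
        indicatorConstLp_coeFn (p := 1) (hs := hs) (hμs := hμs.ne) (c := (1 : ℝ)),
        Lp.coeFn_smul c (indicatorConstLp 1 hs hμs.ne (1 : ℝ))] with x h1 h2 h3
      rw [h1, h3, Pi.smul_apply, h2]
      by_cases hx : x ∈ s <;> simp [hx]
    rw [h]
    exact V.smul_mem c (hset s hs hμs.ne)
  · intro f g hf hg _ hfV hgV
    exact V.add_mem hfV hgV

/-- The integrals over the intervals `(n, n + 1]` are functionals on `L¹(ℝ)` that are dual to
their indicators. -/
theorem not_finiteDimensional_L1_real :
    ¬ FiniteDimensional ℝ (Lp ℝ 1 (volume : Measure ℝ)) := by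
  intro _
  let u : ℕ → Lp ℝ 1 (volume : Measure ℝ) := fun n =>
    indicatorConstLp 1 (measurableSet_Ioc (a := (n : ℝ)) (b := n + 1)) measure_Ioc_lt_top.ne 1
  let F (n : ℕ) : Lp ℝ 1 (volume : Measure ℝ) →ₗ[ℝ] ℝ :=
    { toFun := fun g => ∫ x in Ioc (n : ℝ) (n + 1), g x
      map_add' := fun g h => by
        rw [← integral_add (L1.integrable_coeFn g).integrableOn (L1.integrable_coeFn h).integrableOn]
        exact integral_congr_ae (ae_restrict_of_ae (Lp.coeFn_add g h))
      map_smul' := fun c g => by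
        rw [RingHom.id_apply, ← integral_smul]
        exact integral_congr_ae (ae_restrict_of_ae (Lp.coeFn_smul c g)) }
  have hF (m n : ℕ) : F m (u n) = if n = m then 1 else 0 := by
    have h1 : F m (u n) = ∫ x in Ioc (m : ℝ) (m + 1),
        (Ioc (n : ℝ) (n + 1)).indicator (fun _ => (1 : ℝ)) x :=
      integral_congr_ae (ae_restrict_of_ae indicatorConstLp_coeFn)
    rw [h1, setIntegral_indicator measurableSet_Ioc]
    split_ifs with h
    · subst h; simp
    · have : Ioc (m : ℝ) (m + 1) ∩ Ioc (n : ℝ) (n + 1) = ∅ := by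
        refine disjoint_iff_inter_eq_empty.1 ?_
        have := pairwise_disjoint_Ioc_add_intCast (0 : ℝ) (i := (m : ℤ)) (j := n)
          (by exact_mod_cast Ne.symm h)
        simpa [Function.onFun] using this
      simp [this]
  have hli : LinearIndependent ℝ u := by
    rw [linearIndependent_iff']
    intro s a hs i hi
    have := congrArg (F i) hs
    simpa [hF, hi] using this
  exact not_finite_iff_infinite.2 inferInstance hli.finite

/-! ### Rescaling `L¹(ℝ)` to a bounded interval -/

/-- The substitution `x = tan s` embeds `L¹(ℝ)` isometrically into `L¹(ℝ)`, with image in the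
functions that vanish outside `(-π/2, π/2)`. -/
theorem exists_linearIsometry_L1_supported_Ioo :
    ∃ S : Lp ℝ 1 (volume : Measure ℝ) →ₗᵢ[ℝ] Lp ℝ 1 (volume : Measure ℝ),
      ∀ g, ∀ᵐ s, s ∉ Ioo (-(Real.pi / 2)) (Real.pi / 2) → S g s = 0 := by
  set I : Set ℝ := Ioo (-(Real.pi / 2)) (Real.pi / 2) with hI
  have hIm : MeasurableSet I := measurableSet_Ioo
  let d : ℝ → ℝ := fun s => 1 / Real.cos s ^ 2
  have hd (s : ℝ) (hs : s ∈ I) : HasDerivWithinAt Real.tan (d s) I s :=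
    (Real.hasDerivAt_tan_of_mem_Ioo hs).hasDerivWithinAt
  have hd0 (s : ℝ) : 0 ≤ d s := by positivity
  let Q : (ℝ → ℝ) → ℝ → ℝ := fun g => I.indicator fun s => d s * g (Real.tan s)
  have hint {g : ℝ → ℝ} (hg : Integrable g) : Integrable (Q g) := by
    rw [integrable_indicator_iff hIm]
    have h := integrableOn_image_iff_integrableOn_abs_deriv_smul hIm hd Real.injOn_tan g
    rw [Real.image_tan_Ioo, integrableOn_univ] at h
    simpa [abs_of_nonneg (hd0 _)] using h.1 hg
  have hQint (g : ℝ → ℝ) : ∫ s, Q g s = ∫ x, g x := by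
    rw [integral_indicator hIm]
    have h := integral_image_eq_integral_abs_deriv_smul hIm hd Real.injOn_tan g
    rw [Real.image_tan_Ioo, setIntegral_univ] at h
    simpa [abs_of_nonneg (hd0 _)] using h.symm
  -- the preimage of a null set under `tan` on `I` is its image under the smooth map `arctan`
  have hQae {g h : ℝ → ℝ} (hgh : g =ᵐ[volume] h) : Q g =ᵐ[volume] Q h := by
    have h0 : volume (Real.arctan '' {x | ¬ g x = h x}) = 0 :=
      addHaar_image_eq_zero_of_differentiableOn_of_addHaar_eq_zero volume
        Real.differentiable_arctan.differentiableOn hgh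
    refine measure_mono_null (fun s hs => ?_) h0
    by_cases hsI : s ∈ I
    · refine ⟨Real.tan s, fun he => hs ?_, Real.arctan_tan hsI.1 hsI.2⟩
      change I.indicator _ s = I.indicator _ s
      rw [indicator_of_mem hsI, indicator_of_mem hsI, he]
    · exact absurd (by simp [Q, hsI]) hs
  let S₀ : Lp ℝ 1 (volume : Measure ℝ) →ₗ[ℝ] Lp ℝ 1 (volume : Measure ℝ) :=
    { toFun := fun g => (hint (L1.integrable_coeFn g)).toL1 _
      map_add' := fun g h => by
        rw [← Integrable.toL1_add, Integrable.toL1_eq_toL1_iff]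
        refine (hQae (Lp.coeFn_add g h)).trans (Eventually.of_forall fun s => ?_)
        by_cases hs : s ∈ I <;> simp [Q, hs, mul_add]
      map_smul' := fun c g => by
        rw [RingHom.id_apply, ← Integrable.toL1_smul, Integrable.toL1_eq_toL1_iff]
        refine (hQae (Lp.coeFn_smul c g)).trans (Eventually.of_forall fun s => ?_)
        by_cases hs : s ∈ I <;> simp [Q, hs, mul_left_comm] }
  have hS₀ : ∀ g : Lp ℝ 1 (volume : Measure ℝ), ∀ᵐ s, S₀ g s = Q g s :=
    fun g => Integrable.coeFn_toL1 (hint (L1.integrable_coeFn g))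
  refine ⟨⟨S₀, fun g => ?_⟩, fun g => ?_⟩
  · rw [L1.norm_eq_integral_norm, L1.norm_eq_integral_norm, ← hQint fun x => ‖g x‖]
    refine integral_congr_ae ?_
    filter_upwards [hS₀ g] with s hs
    rw [hs]
    by_cases h : s ∈ I
    · simp [Q, h, abs_of_nonneg (hd0 s)]
    · simp [Q, h]
  · filter_upwards [hS₀ g] with s hs hsI
    have h : Q g s = 0 := indicator_of_notMem hsI _
    exact hs.trans h

/-! ### Positively homogeneous functions with prescribed values on a segment -/

theorem exists_biorthogonal_pair {X : Type*} [NormedAddCommGroup X] [NormedSpace ℝ X]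
    (hX : 2 ≤ Module.rank ℝ X) :
    ∃ (e v : X) (e' v' : StrongDual ℝ X), e' e = 1 ∧ e' v = 0 ∧ v' e = 0 ∧ v' v = 1 := by
  have hX1 : 1 < Module.rank ℝ X := lt_of_lt_of_le (by norm_num) hX
  have : Nontrivial X := rank_pos_iff_nontrivial.1 (zero_lt_one.trans hX1)
  obtain ⟨e, he⟩ := exists_ne (0 : X)
  obtain ⟨w, hw⟩ := exists_linearIndependent_pair_of_one_lt_rank hX1 he
  obtain ⟨e', hee⟩ := SeparatingDual.exists_eq_one (R := ℝ) he
  have hv : w - e' w • e ≠ 0 := fun h => by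
    have := (LinearIndependent.pair_iff.1 hw (-(e' w)) 1 (by rw [← h]; module)).2
    norm_num at this
  obtain ⟨v₁, hv₁⟩ := SeparatingDual.exists_eq_one (R := ℝ) hv
  have hev : e' (w - e' w • e) = 0 := by simp [hee]
  refine ⟨e, w - e' w • e, e', v₁ - v₁ e • e', hee, hev, ?_, ?_⟩
  · simp [hee]
  · rw [sub_apply, smul_apply, hev, hv₁]
    simp

/-- The positively homogeneous function on the plane that equals `φ` on the segment
`{1} × [-M, M]`, is constant in `y` on the part of each vertical line outside the cone spanned by
this segment, and vanishes on the half-plane `x ≤ 0`. -/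
noncomputable def coneExtension (M : ℝ) (φ : ℝ → ℝ) (x y : ℝ) : ℝ :=
  max x 0 * φ (max (-(M * max x 0)) (min y (M * max x 0)) / max x 0)

theorem coneExtension_one {M : ℝ} {φ : ℝ → ℝ} {s : ℝ} (hs : s ∈ Icc (-M) M) :
    coneExtension M φ 1 s = φ s := by
  simp [coneExtension, min_eq_left hs.2, max_eq_right hs.1]

theorem coneExtension_mul_mul (M : ℝ) (φ : ℝ → ℝ) {a : ℝ} (ha : 0 ≤ a) (x y : ℝ) :
    coneExtension M φ (a * x) (a * y) = a * coneExtension M φ x y := by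
  have h0 : max (a * x) 0 = a * max x 0 := by rw [mul_max_of_nonneg _ _ ha, mul_zero]
  have h1 : max (-(M * (a * max x 0))) (min (a * y) (M * (a * max x 0))) =
      a * max (-(M * max x 0)) (min y (M * max x 0)) := by
    rw [mul_max_of_nonneg _ (min _ _) ha, mul_min_of_nonneg _ _ ha, mul_neg, mul_left_comm M a]
  rcases ha.eq_or_lt with rfl | ha'
  · simp [coneExtension]
  · rw [coneExtension, coneExtension, h0, h1, mul_div_mul_left _ _ ha'.ne', mul_assoc]

theorem abs_coneExtension_sub_le {M : ℝ} (hM : 0 ≤ M) {φ : ℝ → ℝ} (hφ : LipschitzWith 1 φ)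
    (hφ0 : φ 0 = 0) (x y x' y' : ℝ) :
    |coneExtension M φ x y - coneExtension M φ x' y'| ≤ |y - y'| + 3 * M * |x - x'| := by
  -- a clamped height is `X * a` with `X = max x 0` and slope `|a| ≤ M`, also when `X = 0`
  have hslope (x y : ℝ) : ∃ a, |a| ≤ M ∧
      max (-(M * max x 0)) (min y (M * max x 0)) = max x 0 * a ∧
      coneExtension M φ x y = max x 0 * φ a := by
    refine ⟨max (-(M * max x 0)) (min y (M * max x 0)) / max x 0, ?_, ?_, rfl⟩
    · have hX : 0 ≤ max x 0 := le_max_right _ _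
      rw [abs_div, abs_of_nonneg hX]
      refine div_le_of_le_mul₀ hX hM (abs_le.2 ⟨le_max_left _ _, max_le ?_ (min_le_right _ _)⟩)
      nlinarith [mul_nonneg hM hX]
    · rcases (le_max_right x 0).eq_or_lt with h | h
      · rw [← h]; simp
      · rw [mul_div_cancel₀ _ h.ne']
  obtain ⟨a, ha, hca, hFa⟩ := hslope x y
  obtain ⟨b, hb, hcb, hFb⟩ := hslope x' y'
  have hX : 0 ≤ max x 0 := le_max_right _ _
  have hXX : |max x 0 - max x' 0| ≤ |x - x'| := abs_max_sub_max_le_abs x x' 0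
  have hφb : |φ b| ≤ M := by
    have := hφ.dist_le_mul b 0
    rw [Real.dist_eq, Real.dist_eq, hφ0] at this
    simp at this
    exact this.trans hb
  have hφab : |φ a - φ b| ≤ |a - b| := by
    simpa [Real.dist_eq] using hφ.dist_le_mul a b
  have hclamp : |max x 0 * a - max x' 0 * b| ≤ |y - y'| + M * |x - x'| := by
    have hMX : |M * max x 0 - M * max x' 0| ≤ M * |x - x'| := by
      rw [← mul_sub, abs_mul, abs_of_nonneg hM]
      gcongr
    rw [← hca, ← hcb]
    refine (abs_max_sub_max_le_max _ _ _ _).trans (max_le ?_ ?_)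
    · rw [neg_sub_neg, abs_sub_comm]
      exact hMX.trans (le_add_of_nonneg_left (abs_nonneg _))
    · refine (abs_min_sub_min_le_max _ _ _ _).trans (max_le ?_ ?_)
      · exact le_add_of_nonneg_right (by positivity)
      · exact hMX.trans (le_add_of_nonneg_left (abs_nonneg _))
  rw [hFa, hFb]
  generalize max x 0 = X at *
  generalize max x' 0 = X' at *
  have h1 : X * |a - b| ≤ |y - y'| + M * |x - x'| + M * |x - x'| := by
    calc X * |a - b| = |X * (a - b)| := by rw [abs_mul, abs_of_nonneg hX]
      _ = |(X * a - X' * b) + (X' - X) * b| := by ring_nf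
      _ ≤ |X * a - X' * b| + |X' - X| * |b| := (abs_add_le _ _).trans_eq (by rw [abs_mul])
      _ ≤ (|y - y'| + M * |x - x'|) + |x - x'| * M := by
        rw [abs_sub_comm X' X]; gcongr
      _ = _ := by ring
  calc |X * φ a - X' * φ b| = |X * (φ a - φ b) + (X - X') * φ b| := by ring_nf
    _ ≤ X * |φ a - φ b| + |X - X'| * |φ b| :=
      (abs_add_le _ _).trans_eq (by rw [abs_mul, abs_mul, abs_of_nonneg hX])
    _ ≤ X * |a - b| + |x - x'| * M := by gcongr
    _ ≤ _ := by linarith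

section Line

variable {X : Type*} [NormedAddCommGroup X] [NormedSpace ℝ X]

/-- On `[-M, M]`, every `1`-Lipschitz function vanishing at `0` is the trace on the segment
`e + [-M, M] • v` of a positively homogeneous function, with a bound on its norm that does not
depend on `φ`. -/
theorem exists_lip0ph_eq_on_segment {e v : X} {e' v' : StrongDual ℝ X} (hee : e' e = 1)
    (hev : e' v = 0) (hve : v' e = 0) (hvv : v' v = 1) {M : ℝ} (hM : 0 ≤ M) {φ : ℝ → ℝ}
    (hφ : LipschitzWith 1 φ) (hφ0 : φ 0 = 0) :
    ∃ f : Lip0ph X, ‖f‖ ≤ ‖v'‖ + 3 * M * ‖e'‖ ∧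
      ∀ s ∈ Icc (-M) M, f.1 (e + s • v) = φ s := by
  have hC : 0 ≤ ‖v'‖ + 3 * M * ‖e'‖ := by positivity
  have hlip (z w : X) : |coneExtension M φ (e' z) (v' z) - coneExtension M φ (e' w) (v' w)| ≤
      (‖v'‖ + 3 * M * ‖e'‖) * ‖z - w‖ := by
    refine (abs_coneExtension_sub_le hM hφ hφ0 _ _ _ _).trans ?_
    have h1 : |v' z - v' w| ≤ ‖v'‖ * ‖z - w‖ := by
      rw [← map_sub]; exact v'.le_opNorm _
    have h2 : |e' z - e' w| ≤ ‖e'‖ * ‖z - w‖ := by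
      rw [← map_sub]; exact e'.le_opNorm _
    calc _ ≤ ‖v'‖ * ‖z - w‖ + 3 * M * (‖e'‖ * ‖z - w‖) := by gcongr
      _ = _ := by ring
  let f : Lip0 X := ⟨fun z => coneExtension M φ (e' z) (v' z),
    ⟨⟨_, hC⟩, LipschitzWith.of_dist_le_mul fun z w => by
      rw [Real.dist_eq, dist_eq_norm]; exact hlip z w⟩, by simp [coneExtension]⟩
  refine ⟨⟨f, fun a ha z => ?_⟩, Lip0.lipNumber_le f hC hlip, fun s hs => ?_⟩
  · change coneExtension M φ (e' (a • z)) (v' (a • z)) = a * coneExtension M φ (e' z) (v' z)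
    rw [map_smul, map_smul, smul_eq_mul, smul_eq_mul, coneExtension_mul_mul M φ ha]
  · change coneExtension M φ (e' (e + s • v)) (v' (e + s • v)) = φ s
    rw [← coneExtension_one (φ := φ) hs]
    simp [hee, hev, hve, hvv]

/-! ### Integrating derivatives along a line -/

theorem Lip0.lipschitzWith_line (f : Lip0 X) (e v : X) :
    LipschitzWith (‖f‖₊ * ‖v‖₊) fun s : ℝ => f (e + s • v) := by
  refine LipschitzWith.of_dist_le_mul fun s t => ?_
  rw [Real.dist_eq, Real.dist_eq]
  refine (f.abs_sub_le _ _).trans_eq ?_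
  rw [add_sub_add_left_eq_sub, ← sub_smul, norm_smul, Real.norm_eq_abs, NNReal.coe_mul,
    coe_nnnorm, coe_nnnorm, Lip0.norm_def]
  ring

theorem Lip0.norm_deriv_line_le (f : Lip0 X) (e v : X) (s : ℝ) :
    ‖deriv (fun s : ℝ => f (e + s • v)) s‖ ≤ ‖f‖ * ‖v‖ := by
  simpa using norm_deriv_le_of_lipschitz (x₀ := s) (f.lipschitzWith_line e v)

theorem Lip0.integrable_mul_deriv_line (f : Lip0 X) (e v : X) {g : ℝ → ℝ} (hg : Integrable g) :
    Integrable fun s => g s * deriv (fun s : ℝ => f (e + s • v)) s :=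
  hg.mul_bdd (measurable_deriv _).aestronglyMeasurable
    (Eventually.of_forall (f.norm_deriv_line_le e v))

/-- The operator sending `g ∈ L¹(ℝ)` to the functional `f ↦ ∫ g(s) (d/ds) f(e + s v) ds` on
`Lip₀^{ph}(X)`. -/
noncomputable def lineDerivIntegral (e v : X) :
    Lp ℝ 1 (volume : Measure ℝ) →L[ℝ] StrongDual ℝ (Lip0ph X) :=
  LinearMap.mkContinuous₂
    (LinearMap.mk₂ ℝ (fun g f => ∫ s, g s * deriv (fun s : ℝ => f.1 (e + s • v)) s)
      (fun g h f => by
        rw [← integral_add (f.1.integrable_mul_deriv_line e v (L1.integrable_coeFn g))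
          (f.1.integrable_mul_deriv_line e v (L1.integrable_coeFn h))]
        refine integral_congr_ae ?_
        filter_upwards [Lp.coeFn_add g h] with s hs
        rw [hs, Pi.add_apply, add_mul])
      (fun c g f => by
        rw [← integral_smul]
        refine integral_congr_ae ?_
        filter_upwards [Lp.coeFn_smul c g] with s hs
        rw [hs, Pi.smul_apply, smul_eq_mul, smul_eq_mul, mul_assoc])
      (fun g f h => by
        rw [← integral_add (f.1.integrable_mul_deriv_line e v (L1.integrable_coeFn g))
          (h.1.integrable_mul_deriv_line e v (L1.integrable_coeFn g))]
        refine integral_congr_ae ?_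
        filter_upwards [(f.1.lipschitzWith_line e v).ae_differentiableAt_of_real (μ := volume),
          (h.1.lipschitzWith_line e v).ae_differentiableAt_of_real (μ := volume)] with s hf hh
        rw [← mul_add, ← deriv_fun_add hf hh]
        rfl)
      (fun c g f => by
        rw [← integral_smul]
        refine integral_congr_ae ?_
        filter_upwards [(f.1.lipschitzWith_line e v).ae_differentiableAt_of_real (μ := volume)]
          with s hf
        rw [smul_eq_mul, mul_left_comm, ← deriv_const_mul c hf]
        rfl)) ‖v‖
    fun g f => by
      rw [LinearMap.mk₂_apply, L1.norm_eq_integral_norm]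
      refine (norm_integral_le_of_norm_le
        ((L1.integrable_coeFn g).norm.mul_const (‖f‖ * ‖v‖))
        (Eventually.of_forall fun s => ?_)).trans_eq ?_
      · rw [norm_mul]
        exact mul_le_mul_of_nonneg_left (f.1.norm_deriv_line_le e v s) (norm_nonneg _)
      · rw [integral_mul_const]; ring

theorem lineDerivIntegral_apply (e v : X) (g : Lp ℝ 1 (volume : Measure ℝ)) (f : Lip0ph X) :
    lineDerivIntegral e v g f = ∫ s, g s * deriv (fun s : ℝ => f.1 (e + s • v)) s := rfl

/-- By the fundamental theorem of calculus for Lipschitz functions, the indicator of an interval is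
sent to a difference of two evaluations. -/
theorem lineDerivIntegral_indicator_Ioc (e v : X) {a b : ℝ} (hab : a ≤ b)
    (hm : MeasurableSet (Ioc a b)) (hμ : volume (Ioc a b) ≠ ⊤) :
    lineDerivIntegral e v (indicatorConstLp 1 hm hμ (1 : ℝ)) =
      deltaPh (e + b • v) - deltaPh (e + a • v) := by
  ext f
  have hac : AbsolutelyContinuousOnInterval (fun s : ℝ => f.1 (e + s • v)) a b :=
    (f.1.lipschitzWith_line e v).lipschitzOnWith.absolutelyContinuousOnInterval
  rw [lineDerivIntegral_apply]
  change _ = f.1 (e + b • v) - f.1 (e + a • v)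
  rw [← hac.integral_deriv_eq_sub, intervalIntegral.integral_of_le hab, ← integral_indicator hm]
  refine integral_congr_ae ?_
  filter_upwards [indicatorConstLp_coeFn (p := 1) (hs := hm) (hμs := hμ) (c := (1 : ℝ))] with s hs
  rw [hs]
  by_cases h : s ∈ Ioc a b <;> simp [h]

theorem lineDerivIntegral_mem_Fph (e v : X) (g : Lp ℝ 1 (volume : Measure ℝ)) :
    lineDerivIntegral e v g ∈ Fph X := by
  have hcl : IsClosed (Fph X : Set (StrongDual ℝ (Lip0ph X))) :=
    Submodule.isClosed_topologicalClosure _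
  have hδ (x : X) : deltaPh x ∈ Fph X :=
    Submodule.le_topologicalClosure _ (Submodule.subset_span (mem_range_self x))
  have h : (Fph X).comap (lineDerivIntegral e v).toLinearMap = ⊤ := by
    refine eq_top_of_indicatorConstLp_Ioc_mem
      (hcl.preimage (lineDerivIntegral e v).continuous) fun a b hm hμ => ?_
    rcases le_total a b with hab | hab
    · have := (Fph X).sub_mem (hδ (e + b • v)) (hδ (e + a • v))
      rwa [← lineDerivIntegral_indicator_Ioc e v hab hm hμ] at this
    · have h0 : indicatorConstLp 1 hm hμ (1 : ℝ) = 0 := by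
        simp only [Ioc_eq_empty hab.not_gt]
        exact indicatorConstLp_empty
      rw [h0]
      exact Submodule.zero_mem _
  exact (h ▸ Submodule.mem_top : g ∈ (Fph X).comap _)

/-- Testing against an extension of a primitive of `sign g` bounds `‖g‖` by the norm of its
functional, when `g` is supported in `[-M, M]`. -/
theorem norm_le_mul_norm_lineDerivIntegral {e v : X} {e' v' : StrongDual ℝ X} (hee : e' e = 1)
    (hev : e' v = 0) (hve : v' e = 0) (hvv : v' v = 1) {M : ℝ} (hM : 0 ≤ M)
    (g : Lp ℝ 1 (volume : Measure ℝ)) (hg : ∀ᵐ s, s ∉ Ioo (-M) M → g s = 0) :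
    ‖g‖ ≤ (‖v'‖ + 3 * M * ‖e'‖) * ‖lineDerivIntegral e v g‖ := by
  classical
  let h : ℝ → ℝ := fun s => if 0 ≤ g s then 1 else -1
  have hgm : Measurable g := (Lp.stronglyMeasurable g).measurable
  have hhm : Measurable h :=
    Measurable.ite (measurableSet_le measurable_const hgm) measurable_const measurable_const
  have hh1 (s : ℝ) : ‖h s‖ ≤ 1 := by
    by_cases hs : 0 ≤ g s <;> simp [h, hs]
  have hgh (s : ℝ) : g s * h s = ‖g s‖ := by
    by_cases hs : 0 ≤ g s
    · simp [h, hs, abs_of_nonneg hs]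
    · simp [h, hs, abs_of_neg (not_le.1 hs)]
  have hloc : LocallyIntegrable h volume :=
    (locallyIntegrable_const (1 : ℝ)).mono hhm.aestronglyMeasurable
      (Eventually.of_forall fun s => by simpa using hh1 s)
  have hii (a b : ℝ) : IntervalIntegrable h volume a b :=
    intervalIntegrable_iff.2
      ((hloc.integrableOn_isCompact isCompact_uIcc).mono_set uIoc_subset_uIcc)
  let φ : ℝ → ℝ := fun s => ∫ u in (0 : ℝ)..s, h u
  have hφ : LipschitzWith 1 φ := by
    refine LipschitzWith.of_dist_le_mul fun s t => ?_
    rw [dist_eq_norm, intervalIntegral.integral_interval_sub_left (hii _ _) (hii _ _),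
      Real.dist_eq, NNReal.coe_one]
    exact intervalIntegral.norm_integral_le_of_norm_le_const fun u _ => hh1 u
  obtain ⟨f, hfn, hf⟩ := exists_lip0ph_eq_on_segment hee hev hve hvv hM hφ
    (intervalIntegral.integral_same)
  have hval : lineDerivIntegral e v g f = ‖g‖ := by
    rw [lineDerivIntegral_apply, L1.norm_eq_integral_norm]
    refine integral_congr_ae ?_
    filter_upwards [hg, LocallyIntegrable.ae_hasDerivAt_integral hloc] with s hs hder
    by_cases hsI : s ∈ Ioo (-M) M
    · have heq : (fun s : ℝ => f.1 (e + s • v)) =ᶠ[𝓝 s] φ := by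
        filter_upwards [Ioo_mem_nhds hsI.1 hsI.2] with t ht
        exact hf t (Ioo_subset_Icc_self ht)
      rw [heq.deriv_eq, (hder 0).deriv, hgh]
    · simp [hs hsI]
  calc ‖g‖ = ‖lineDerivIntegral e v g f‖ := by rw [hval, norm_norm]
    _ ≤ ‖lineDerivIntegral e v g‖ * ‖f‖ := ContinuousLinearMap.le_opNorm _ _
    _ ≤ ‖lineDerivIntegral e v g‖ * (‖v'‖ + 3 * M * ‖e'‖) := by gcongr
    _ = _ := mul_comm _ _

end Line

/-! ### The embedding of `L¹(ℝ)` -/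

theorem ContinuousLinearMap.exists_closed_submodule_equiv_of_norm_le {E F : Type*}
    [NormedAddCommGroup E] [NormedSpace ℝ E] [CompleteSpace E] [NormedAddCommGroup F]
    [NormedSpace ℝ F] [CompleteSpace F] (T : E →L[ℝ] F) (W : Submodule ℝ F)
    (hW : IsClosed (W : Set F)) (hTW : ∀ g, T g ∈ W) (K : ℝ≥0) (hK : ∀ g, ‖g‖ ≤ K * ‖T g‖) :
    ∃ R : Submodule ℝ W, IsClosed (R : Set W) ∧ Nonempty (E ≃L[ℝ] R) := by
  let U : E →L[ℝ] W := T.codRestrict W hTW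
  have hU : AntilipschitzWith K U := U.antilipschitz_of_bound hK
  have : CompleteSpace W := hW.completeSpace_coe
  have hcl : IsClosed (range U) := hU.isClosed_range U.uniformContinuous
  exact ⟨U.range, hcl, ⟨U.equivRange hU.injective hcl⟩⟩

theorem mainTheorem1 (X : Type*) [NormedAddCommGroup X] [NormedSpace ℝ X] [CompleteSpace X]
    (hX : 2 ≤ Module.rank ℝ X) :
    (∃ E : Submodule ℝ (Fph X), IsClosed (E : Set (Fph X)) ∧
      Nonempty (Lp ℝ 1 (volume : Measure ℝ) ≃L[ℝ] E)) ∧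
    ¬ FiniteDimensional ℝ (Lip0ph X) := by
  obtain ⟨e, v, e', v', hee, hev, hve, hvv⟩ := exists_biorthogonal_pair hX
  obtain ⟨S, hS⟩ := exists_linearIsometry_L1_supported_Ioo
  let T : Lp ℝ 1 (volume : Measure ℝ) →L[ℝ] StrongDual ℝ (Lip0ph X) :=
    (lineDerivIntegral e v).comp S.toContinuousLinearMap
  have hM : 0 ≤ Real.pi / 2 := by positivity
  let K : ℝ≥0 := ⟨‖v'‖ + 3 * (Real.pi / 2) * ‖e'‖, by positivity⟩
  have hK (g : Lp ℝ 1 (volume : Measure ℝ)) : ‖g‖ ≤ K * ‖T g‖ := by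
    rw [← S.norm_map g]
    exact norm_le_mul_norm_lineDerivIntegral hee hev hve hvv hM (S g) (hS g)
  obtain ⟨R, hR, ⟨Φ⟩⟩ := ContinuousLinearMap.exists_closed_submodule_equiv_of_norm_le
    (F := StrongDual ℝ (Lip0ph X)) T (Fph X)
    (Submodule.isClosed_topologicalClosure _) (fun g => lineDerivIntegral_mem_Fph e v (S g)) K hK
  -- `Φ` carries finite-dimensionality of the dual, inherited by `R`, back to `L¹(ℝ)`
  refine ⟨⟨R, hR, ⟨Φ⟩⟩, fun _ => ?_⟩
  exact not_finiteDimensional_L1_real Φ.symm.toLinearEquiv.finiteDimensional
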